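/- Let $\mathcal D=\mathbb C\langle x_1,x_2,\eta,\partial_1,\partial_2,\partial_\eta\rangle$ be the Weyl algebra in the variables $(x_1,x_2,\eta)$, where $\partial_1=\partial/\partial x_1$, $\partial_2=\partial/\partial x_2$, $\partial_\eta=\partial/\partial\eta$, and let $\mathcal I\subset\mathcal D$ be the left ideal generated by \begin{align*} P_1&=4\partial_1\partial_2+2\eta x_2\partial_1+\eta^2x_1,\\ P_2&=4\partial_2^2+\eta x_1\partial_1+2\eta x_2\partial_2+\eta,\\ P_3&=\eta\partial_2-\partial_1^2,\\ P_4&=3x_1\partial_1+2x_2\partial_2-4\eta\partial_\eta-1. \end{align*} Then the left $\mathcal D$-module $\mathcal M=\mathcal D/\mathcal I$ is holonomic (it is zero or its characteristic variety, with respect to the order filtration, has dimension $3$), and its rank, that is, the dimension of $\mathbb C(x_1,x_2,\eta)\otimes_{\mathbb C[x_1,x_2,\eta]}\mathcal M$ over $\mathbb C(x_1,x_2,\eta)$, equals $3$. -/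

import Mathlib

open scoped TensorProduct

noncomputable section

/-- The relation on the free algebra on `x_i` (`Sum.inl i`) and `∂_i` (`Sum.inr i`) that presents
the Weyl algebra. -/
inductive WeylRel (n : ℕ) :
    FreeAlgebra ℂ (Fin n ⊕ Fin n) → FreeAlgebra ℂ (Fin n ⊕ Fin n) → Prop
  | x_comm (i j : Fin n) : WeylRel n
      (FreeAlgebra.ι ℂ (Sum.inl i) * FreeAlgebra.ι ℂ (Sum.inl j))
      (FreeAlgebra.ι ℂ (Sum.inl j) * FreeAlgebra.ι ℂ (Sum.inl i))
  | d_comm (i j : Fin n) : WeylRel n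
      (FreeAlgebra.ι ℂ (Sum.inr i) * FreeAlgebra.ι ℂ (Sum.inr j))
      (FreeAlgebra.ι ℂ (Sum.inr j) * FreeAlgebra.ι ℂ (Sum.inr i))
  | leibniz (i j : Fin n) : WeylRel n
      (FreeAlgebra.ι ℂ (Sum.inr i) * FreeAlgebra.ι ℂ (Sum.inl j))
      (FreeAlgebra.ι ℂ (Sum.inl j) * FreeAlgebra.ι ℂ (Sum.inr i) + if i = j then 1 else 0)

/-- The `n`-th Weyl algebra over `ℂ`. -/
def WeylAlgebra (n : ℕ) : Type := RingQuot (WeylRel n)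

namespace WeylAlgebra

instance (n : ℕ) : Ring (WeylAlgebra n) := inferInstanceAs (Ring (RingQuot (WeylRel n)))

instance (n : ℕ) : Algebra ℂ (WeylAlgebra n) :=
  inferInstanceAs (Algebra ℂ (RingQuot (WeylRel n)))

/-- The coordinate `x_i`. -/
def x {n : ℕ} (i : Fin n) : WeylAlgebra n :=
  RingQuot.mkAlgHom ℂ (WeylRel n) (FreeAlgebra.ι ℂ (Sum.inl i))

/-- The derivation `∂_i`. -/
def d {n : ℕ} (i : Fin n) : WeylAlgebra n :=
  RingQuot.mkAlgHom ℂ (WeylRel n) (FreeAlgebra.ι ℂ (Sum.inr i))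

theorem x_mul_x {n : ℕ} (i j : Fin n) : (x i : WeylAlgebra n) * x j = x j * x i := by
  have h := RingQuot.mkAlgHom_rel ℂ (WeylRel.x_comm i j)
  rw [map_mul, map_mul] at h
  exact h

theorem d_mul_d {n : ℕ} (i j : Fin n) : (d i : WeylAlgebra n) * d j = d j * d i := by
  have h := RingQuot.mkAlgHom_rel ℂ (WeylRel.d_comm i j)
  rw [map_mul, map_mul] at h
  exact h

open scoped IsMulCommutative in
/-- Evaluation of commutative polynomials at a commuting family of elements of a possibly
noncommutative algebra. -/
def commEval {n : ℕ} {R : Type*} [Ring R] [Algebra ℂ R] (f : Fin n → R)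
    (hf : ∀ i j, f i * f j = f j * f i) : MvPolynomial (Fin n) ℂ →ₐ[ℂ] R :=
  haveI : IsMulCommutative (Algebra.adjoin ℂ (Set.range f)) :=
    Algebra.isMulCommutative_adjoin ℂ (by
      rintro _ ⟨i, rfl⟩ _ ⟨j, rfl⟩
      exact hf i j)
  (Algebra.adjoin ℂ (Set.range f)).val.comp
    (MvPolynomial.aeval (fun i => (⟨f i, Algebra.subset_adjoin ⟨i, rfl⟩⟩ :
      Algebra.adjoin ℂ (Set.range f))))

/-- The inclusion `ℂ[x] → D` of the polynomials in the coordinates. -/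
def ofPoly (n : ℕ) : MvPolynomial (Fin n) ℂ →ₐ[ℂ] WeylAlgebra n := commEval x x_mul_x

/-- The inclusion `ℂ[∂] → D` of the operators with constant coefficients. -/
def ofConst (n : ℕ) : MvPolynomial (Fin n) ℂ →ₐ[ℂ] WeylAlgebra n := commEval d d_mul_d

/-- The polynomial ring `ℂ[x][ξ]`, the associated graded ring of the Weyl algebra for the order
filtration (the coordinate ring of the cotangent bundle of affine `n`-space). -/
abbrev SymbolRing (n : ℕ) : Type := MvPolynomial (Fin n) (MvPolynomial (Fin n) ℂ)

/-- The operator `∑ a_β(x) ∂^β` with total symbol `∑ a_β(x) ξ^β`. -/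
def op {n : ℕ} (p : SymbolRing n) : WeylAlgebra n :=
  ∑ β ∈ p.support, ofPoly n (p.coeff β) * ofConst n (MvPolynomial.monomial β 1)

/-- The operators of order at most `k`. -/
def orderFiltration (n k : ℕ) : Set (WeylAlgebra n) :=
  {P | ∃ p : SymbolRing n, p.totalDegree ≤ k ∧ op p = P}

/-- Good filtrations of a left `D`-module with respect to the order filtration of `D`. -/
structure IsGoodFiltration (n : ℕ) {M : Type*} [AddCommGroup M] [Module (WeylAlgebra n) M]
    (Γ : ℤ → AddSubgroup M) : Prop where
  mono : Monotone Γ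
  bounded_below : ∃ k₀ : ℤ, ∀ k ≤ k₀, Γ k = ⊥
  exhaustive : ∀ m : M, ∃ k, m ∈ Γ k
  smul_mem : ∀ (i : ℕ) (j : ℤ), ∀ P ∈ orderFiltration n i, ∀ m ∈ Γ j, P • m ∈ Γ (j + i)
  /-- Every step is a finitely generated `ℂ[x]`-module. -/
  finite : ∀ k, ∃ S : Finset M,
    Γ k = AddSubgroup.closure {m | ∃ a : MvPolynomial (Fin n) ℂ, ∃ s ∈ S, m = ofPoly n a • s}
  /-- From some step on, the filtration is generated by the order filtration. -/
  generated : ∃ k₀ : ℤ, ∀ k ≥ k₀, ∀ i : ℕ,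
    Γ (k + i) = AddSubgroup.closure {m | ∃ P ∈ orderFiltration n i, ∃ u ∈ Γ k, m = P • u}

/-- The annihilator of `gr M` in `ℂ[x][ξ]` for a filtration `Γ` of `M`: it is generated by the
principal symbols `σ_k(P)` of the operators `P` of order at most `k` with
`P Γ_j ⊆ Γ_{j+k-1}` for all `j`. Its zero locus is the characteristic variety of `M` if `Γ` is
a good filtration. -/
def charIdeal (n : ℕ) {M : Type*} [AddCommGroup M] [Module (WeylAlgebra n) M]
    (Γ : ℤ → AddSubgroup M) : Ideal (SymbolRing n) :=
  Ideal.span {q | ∃ (k : ℕ) (p : SymbolRing n), p.totalDegree ≤ k ∧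
    (∀ (j : ℤ), ∀ m ∈ Γ j, op p • m ∈ Γ (j + k - 1)) ∧
    q = MvPolynomial.homogeneousComponent k p}

/-- A left `D`-module is holonomic if it is zero, or finitely generated with characteristic
variety of dimension `n` (having a good filtration is the same as being finitely generated, and
the characteristic variety does not depend on the good filtration). -/
def IsHolonomic (n : ℕ) (M : Type*) [AddCommGroup M] [Module (WeylAlgebra n) M] : Prop :=
  Subsingleton M ∨ ∃ Γ : ℤ → AddSubgroup M, IsGoodFiltration n Γ ∧
    ringKrullDim (SymbolRing n ⧸ charIdeal n Γ) = n

/-- The rank of a left `D`-module `M`: the dimension of `ℂ(x) ⊗_{ℂ[x]} M` over `ℂ(x)`. -/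
def holonomicRank (n : ℕ) (M : Type*) [AddCommGroup M] [Module (WeylAlgebra n) M] : Cardinal :=
  letI : Module (MvPolynomial (Fin n) ℂ) M := Module.compHom M (ofPoly n).toRingHom
  Module.rank (FractionRing (MvPolynomial (Fin n) ℂ))
    (FractionRing (MvPolynomial (Fin n) ℂ) ⊗[MvPolynomial (Fin n) ℂ] M)

end WeylAlgebra

namespace Pearcey

open WeylAlgebra

/-- The variables are `x₁ = x 0`, `x₂ = x 1`, `η = x 2`. -/
abbrev x₁ : WeylAlgebra 3 := x 0
/-- The variable `x₂`. -/
abbrev x₂ : WeylAlgebra 3 := x 1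
/-- The variable `η`. -/
abbrev η : WeylAlgebra 3 := x 2
/-- The derivation `∂/∂x₁`. -/
abbrev d₁ : WeylAlgebra 3 := d 0
/-- The derivation `∂/∂x₂`. -/
abbrev d₂ : WeylAlgebra 3 := d 1
/-- The derivation `∂/∂η`. -/
abbrev dη : WeylAlgebra 3 := d 2

/-- `P₁ = 4 ∂₁ ∂₂ + 2 η x₂ ∂₁ + η² x₁`. -/
def P₁ : WeylAlgebra 3 := 4 * d₁ * d₂ + 2 * η * x₂ * d₁ + η ^ 2 * x₁

/-- `P₂ = 4 ∂₂² + η x₁ ∂₁ + 2 η x₂ ∂₂ + η`. -/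
def P₂ : WeylAlgebra 3 := 4 * d₂ ^ 2 + η * x₁ * d₁ + 2 * η * x₂ * d₂ + η

/-- `P₃ = η ∂₂ - ∂₁²`. -/
def P₃ : WeylAlgebra 3 := η * d₂ - d₁ ^ 2

/-- `P₄ = 3 x₁ ∂₁ + 2 x₂ ∂₂ - 4 η ∂_η - 1`. -/
def P₄ : WeylAlgebra 3 := 3 * x₁ * d₁ + 2 * x₂ * d₂ - 4 * η * dη - 1

/-- The left ideal generated by `P₁, P₂, P₃, P₄` (over a noncommutative ring, `Ideal` means
left ideal). -/
def I : Ideal (WeylAlgebra 3) := Ideal.span {P₁, P₂, P₃, P₄}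

end Pearcey

end

/-! Write D for the Weyl algebra, M = D/I and K = ℂ(x₁, x₂, η). Modulo I, the generators rewrite
∂₁², ∂₁∂₂, ∂₂² and η∂_η as ℂ[x]-combinations of 1, ∂₁, ∂₂.

Rank at most 3: each η∂_i preserves the ℂ[x]-span of 1, ∂₁, ∂₂ in M, so a power of η moves any
element of M into that span (`exists_eta_pow_smul_mem`), and η is invertible in K.

Rank at least 3: the same rewriting gives three connection matrices over K. They satisfy the
integrability condition (`connectionMatrix_integrable`), so D acts on K³. The first basis vector is
killed by I (`I_le_ker`), and the induced map M → K³ sends 1, ∂₁, ∂₂ to the standard basis.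

Holonomicity: filter M by the image of the order filtration. Since gr D is commutative, principal
symbols of elements of I lie in the characteristic ideal (`homogeneousComponent_mem_charIdeal`). The
symbols of P₂, P₃, P₄ force ξ₁ = ξ₂ = ηξ_η = 0, a locus of dimension at most 3. Conversely, no
nonzero polynomial lies in I, as is seen in K³, so the characteristic variety contains the zero
section, of dimension 3. -/

namespace WeylAlgebra

/-! ### Normally ordered operators and the order filtration. -/

variable {n : ℕ}

theorem d_mul_x (i j : Fin n) :
    (d i : WeylAlgebra n) * x j = x j * d i + if i = j then 1 else 0 := by
  have h := RingQuot.mkAlgHom_rel ℂ (WeylRel.leibniz i j)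
  rw [map_mul, map_add, map_mul, apply_ite (RingQuot.mkAlgHom ℂ (WeylRel n)), map_one,
    map_zero] at h
  exact h

@[simp]
theorem commEval_X {R : Type*} [Ring R] [Algebra ℂ R] (f : Fin n → R)
    (hf : ∀ i j, f i * f j = f j * f i) (i : Fin n) :
    commEval f hf (MvPolynomial.X i) = f i := by
  simp [commEval]

@[simp]
theorem ofPoly_X (i : Fin n) : ofPoly n (MvPolynomial.X i) = x i := commEval_X _ _ _

@[simp]
theorem ofConst_X (i : Fin n) : ofConst n (MvPolynomial.X i) = d i := commEval_X _ _ _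

/-- The operator `∂^β`. -/
noncomputable def dPow (β : Fin n →₀ ℕ) : WeylAlgebra n := ofConst n (MvPolynomial.monomial β 1)

@[simp]
theorem dPow_zero : dPow (0 : Fin n →₀ ℕ) = 1 := map_one (ofConst n)

theorem dPow_add (β γ : Fin n →₀ ℕ) : dPow (β + γ) = dPow β * dPow γ := by
  simp [dPow, ← map_mul, MvPolynomial.monomial_mul]

@[simp]
theorem dPow_single (i : Fin n) : dPow (Finsupp.single i 1) = d i := ofConst_X i

theorem exponent_induction {σ : Type*} {p : (σ →₀ ℕ) → Prop} (β : σ →₀ ℕ) (zero : p 0)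
    (add : ∀ i β, p β → p (Finsupp.single i 1 + β)) : p β := by
  classical
  induction β using Finsupp.induction with
  | zero => exact zero
  | single_add i k f _ _ ih =>
    clear * - ih add
    induction k with
    | zero => simpa using ih
    | succ k hk =>
      rw [add_comm k 1, Finsupp.single_add, add_assoc]
      exact add _ _ hk

/-- An induction principle: a subalgebra containing all `x_i` and `∂_i` is everything. -/
theorem subalgebra_eq_top (S : Subalgebra ℂ (WeylAlgebra n)) (hx : ∀ i, x i ∈ S)
    (hd : ∀ i, d i ∈ S) : S = ⊤ := by
  rw [eq_top_iff]
  rintro P -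
  obtain ⟨P, rfl⟩ := RingQuot.mkAlgHom_surjective ℂ (WeylRel n) P
  induction P using FreeAlgebra.induction with
  | grade0 r =>
    rw [AlgHom.commutes]
    exact S.algebraMap_mem r
  | grade1 i =>
    rcases i with i | i
    · exact hx i
    · exact hd i
  | mul a b ha hb =>
    rw [map_mul]
    exact S.mul_mem ha hb
  | add a b ha hb =>
    rw [map_add]
    exact S.add_mem ha hb

theorem d_mul_ofPoly (i : Fin n) (a : MvPolynomial (Fin n) ℂ) :
    d i * ofPoly n a = ofPoly n a * d i + ofPoly n (MvPolynomial.pderiv i a) := by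
  induction a using MvPolynomial.induction_on with
  | C r =>
    rw [MvPolynomial.pderiv_C, map_zero, add_zero]
    have h : ofPoly n (MvPolynomial.C r) = algebraMap ℂ _ r := (ofPoly n).commutes r
    rw [h]
    exact (Algebra.commutes r _).symm
  | add p q hp hq =>
    simp only [map_add, mul_add, add_mul, hp, hq]
    abel
  | mul_X p j hp =>
    rw [Derivation.leibniz, map_add, smul_eq_mul, smul_eq_mul, map_mul, map_mul, map_mul,
      ← mul_assoc, hp, add_mul, mul_assoc _ (d i), ofPoly_X, d_mul_x, MvPolynomial.pderiv_X,
      mul_add, Pi.single_apply, apply_ite (ofPoly n), map_one, map_zero, mul_assoc, add_assoc,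
      ← ofPoly_X, ← map_mul, ← map_mul, mul_comm (MvPolynomial.X j)]
    simp only [eq_comm (a := i)]

/-- The order filtration as additive subgroups, indexed by `ℤ`. -/
noncomputable def orderSubgroup (n : ℕ) (j : ℤ) : AddSubgroup (WeylAlgebra n) :=
  AddSubgroup.closure {P | ∃ (a : MvPolynomial (Fin n) ℂ) (β : Fin n →₀ ℕ),
    (β.degree : ℤ) ≤ j ∧ P = ofPoly n a * dPow β}

theorem ofPoly_mul_dPow_mem (a : MvPolynomial (Fin n) ℂ) {β : Fin n →₀ ℕ} {j : ℤ}
    (h : (β.degree : ℤ) ≤ j) : ofPoly n a * dPow β ∈ orderSubgroup n j :=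
  AddSubgroup.subset_closure ⟨a, β, h, rfl⟩

theorem dPow_mem (β : Fin n →₀ ℕ) : dPow β ∈ orderSubgroup n β.degree := by
  simpa using ofPoly_mul_dPow_mem 1 le_rfl

theorem d_mem (i : Fin n) : d i ∈ orderSubgroup n 1 := by
  simpa using dPow_mem (Finsupp.single i 1)

theorem ofPoly_mem (a : MvPolynomial (Fin n) ℂ) : ofPoly n a ∈ orderSubgroup n 0 := by
  simpa using ofPoly_mul_dPow_mem (j := 0) a (β := 0) (by simp)

theorem x_mem (i : Fin n) : x i ∈ orderSubgroup n 0 := by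
  simpa using ofPoly_mem (MvPolynomial.X i)

theorem orderSubgroup_mono : Monotone (orderSubgroup n) := fun _ _ h ↦
  AddSubgroup.closure_mono (fun _ ⟨a, β, hβ, hP⟩ ↦ ⟨a, β, hβ.trans h, hP⟩)

/-- Degrees of exponents are natural numbers. Besides bounding the filtration below, this turns
membership in step -1 into vanishing. -/
theorem orderSubgroup_of_neg {j : ℤ} (h : j < 0) : orderSubgroup n j = ⊥ := by
  rw [orderSubgroup, AddSubgroup.closure_eq_bot_iff]
  rintro P ⟨a, β, hβ, -⟩
  omega

theorem orderSubgroup_induction {j : ℤ} {H : AddSubgroup (WeylAlgebra n)}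
    (h : ∀ a β, ((Finsupp.degree β : ℕ) : ℤ) ≤ j → ofPoly n a * dPow β ∈ H) :
    orderSubgroup n j ≤ H := by
  rw [orderSubgroup, AddSubgroup.closure_le]
  rintro P ⟨a, β, hβ, rfl⟩
  exact h a β hβ

theorem orderSubgroup_map_mem {j : ℤ} (f : WeylAlgebra n →+ WeylAlgebra n)
    {H : AddSubgroup (WeylAlgebra n)}
    (h : ∀ a β, ((Finsupp.degree β : ℕ) : ℤ) ≤ j → f (ofPoly n a * dPow β) ∈ H)
    {P : WeylAlgebra n} (hP : P ∈ orderSubgroup n j) : f P ∈ H :=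
  orderSubgroup_induction (H := H.comap f) h hP

theorem ofPoly_mul_mem (a : MvPolynomial (Fin n) ℂ) {j : ℤ} {Q : WeylAlgebra n}
    (hQ : Q ∈ orderSubgroup n j) : ofPoly n a * Q ∈ orderSubgroup n j := by
  refine orderSubgroup_map_mem (AddMonoidHom.mulLeft (ofPoly n a)) (fun b β hβ ↦ ?_) hQ
  rw [AddMonoidHom.coe_mulLeft, ← mul_assoc, ← map_mul]
  exact ofPoly_mul_dPow_mem _ hβ

theorem dPow_mul_d (β : Fin n →₀ ℕ) (i : Fin n) : dPow β * d i = d i * dPow β := by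
  rw [← dPow_single, ← dPow_add, add_comm, dPow_add]

/-- Bracketing with `d i` only differentiates the coefficients, so the order does not grow. -/
theorem commutator_d_mem (i : Fin n) {j : ℤ} {Q : WeylAlgebra n} (hQ : Q ∈ orderSubgroup n j) :
    d i * Q - Q * d i ∈ orderSubgroup n j := by
  refine orderSubgroup_map_mem (AddMonoidHom.mulLeft (d i) - AddMonoidHom.mulRight (d i))
    (fun b β hβ ↦ ?_) hQ
  rw [AddMonoidHom.sub_apply, AddMonoidHom.coe_mulLeft, AddMonoidHom.mulRight_apply,
    ← mul_assoc, d_mul_ofPoly, add_mul, mul_assoc, mul_assoc, dPow_mul_d, add_sub_cancel_left]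
  exact ofPoly_mul_dPow_mem _ hβ

theorem mul_d_mem (i : Fin n) {j : ℤ} {Q : WeylAlgebra n} (hQ : Q ∈ orderSubgroup n j) :
    Q * d i ∈ orderSubgroup n (j + 1) := by
  refine orderSubgroup_map_mem (AddMonoidHom.mulRight (d i)) (fun b β hβ ↦ ?_) hQ
  rw [AddMonoidHom.mulRight_apply, mul_assoc, ← dPow_single, ← dPow_add]
  exact ofPoly_mul_dPow_mem _ (by simpa using hβ)

theorem d_mul_mem (i : Fin n) {j : ℤ} {Q : WeylAlgebra n} (hQ : Q ∈ orderSubgroup n j) :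
    d i * Q ∈ orderSubgroup n (j + 1) := by
  rw [← sub_add_cancel (d i * Q) (Q * d i)]
  exact add_mem (orderSubgroup_mono (by omega) (commutator_d_mem i hQ)) (mul_d_mem i hQ)

theorem dPow_mul_mem (β : Fin n →₀ ℕ) {j : ℤ} {Q : WeylAlgebra n}
    (hQ : Q ∈ orderSubgroup n j) : dPow β * Q ∈ orderSubgroup n (β.degree + j) := by
  induction β using exponent_induction with
  | zero => simpa using hQ
  | add i β ih =>
    rw [dPow_add, dPow_single, mul_assoc]
    refine orderSubgroup_mono ?_ (d_mul_mem i ih)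
    rw [map_add, Finsupp.degree_single]
    push_cast
    omega

theorem orderSubgroup_mul_mem {i j : ℤ} {P Q : WeylAlgebra n} (hP : P ∈ orderSubgroup n i)
    (hQ : Q ∈ orderSubgroup n j) : P * Q ∈ orderSubgroup n (i + j) := by
  refine orderSubgroup_map_mem (AddMonoidHom.mulRight Q) (fun b β hβ ↦ ?_) hP
  rw [AddMonoidHom.mulRight_apply, mul_assoc]
  exact ofPoly_mul_mem _ (orderSubgroup_mono (by omega) (dPow_mul_mem β hQ))

theorem commutator_ofPoly_dPow_mem (b : MvPolynomial (Fin n) ℂ) (β : Fin n →₀ ℕ) :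
    ofPoly n b * dPow β - dPow β * ofPoly n b ∈ orderSubgroup n (β.degree - 1) := by
  induction β using exponent_induction with
  | zero => simp
  | add i β ih =>
    rw [dPow_add, dPow_single]
    have key : ofPoly n b * (d i * dPow β) - d i * dPow β * ofPoly n b =
        d i * (ofPoly n b * dPow β - dPow β * ofPoly n b)
          - ofPoly n (MvPolynomial.pderiv i b) * dPow β := by
      rw [mul_sub, ← mul_assoc (d i) (ofPoly n b), d_mul_ofPoly, add_mul]
      simp only [mul_assoc]
      abel
    rw [key]
    refine sub_mem (orderSubgroup_mono ?_ (d_mul_mem i ih)) (ofPoly_mul_dPow_mem _ ?_) <;> simp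

theorem commutator_ofPoly_mem (b : MvPolynomial (Fin n) ℂ) {j : ℤ} {Q : WeylAlgebra n}
    (hQ : Q ∈ orderSubgroup n j) :
    ofPoly n b * Q - Q * ofPoly n b ∈ orderSubgroup n (j - 1) := by
  refine orderSubgroup_map_mem
    (AddMonoidHom.mulLeft (ofPoly n b) - AddMonoidHom.mulRight (ofPoly n b))
    (fun a β hβ ↦ ?_) hQ
  have key : ofPoly n b * (ofPoly n a * dPow β) - ofPoly n a * dPow β * ofPoly n b =
      ofPoly n a * (ofPoly n b * dPow β - dPow β * ofPoly n b) := by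
    rw [mul_sub, ← mul_assoc, ← mul_assoc, ← map_mul, ← map_mul, mul_comm b, mul_assoc]
  rw [AddMonoidHom.sub_apply, AddMonoidHom.coe_mulLeft, AddMonoidHom.mulRight_apply, key]
  exact ofPoly_mul_mem _ (orderSubgroup_mono (by omega) (commutator_ofPoly_dPow_mem b β))

theorem commutator_dPow_mem (β : Fin n →₀ ℕ) {j : ℤ} {Q : WeylAlgebra n}
    (hQ : Q ∈ orderSubgroup n j) :
    dPow β * Q - Q * dPow β ∈ orderSubgroup n (β.degree + j - 1) := by
  induction β using exponent_induction with
  | zero => simp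
  | add i β ih =>
    have key : dPow (Finsupp.single i 1 + β) * Q - Q * dPow (Finsupp.single i 1 + β) =
        d i * (dPow β * Q - Q * dPow β) + (d i * Q - Q * d i) * dPow β := by
      rw [dPow_add, dPow_single]
      noncomm_ring
    rw [key]
    refine add_mem (orderSubgroup_mono ?_ (d_mul_mem i ih))
      (orderSubgroup_mono ?_ (orderSubgroup_mul_mem (commutator_d_mem i hQ) (dPow_mem β)))
    all_goals simp; try omega

/-- This is the commutativity of the associated graded ring. The bracket is a derivation in each
argument, which reduces the claim to brackets with a polynomial and with a power of ∂. -/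
theorem commutator_mem {i j : ℤ} {P Q : WeylAlgebra n} (hP : P ∈ orderSubgroup n i)
    (hQ : Q ∈ orderSubgroup n j) : P * Q - Q * P ∈ orderSubgroup n (i + j - 1) := by
  refine orderSubgroup_map_mem (AddMonoidHom.mulRight Q - AddMonoidHom.mulLeft Q)
    (fun a β hβ ↦ ?_) hP
  have key : ofPoly n a * dPow β * Q - Q * (ofPoly n a * dPow β) =
      ofPoly n a * (dPow β * Q - Q * dPow β) + (ofPoly n a * Q - Q * ofPoly n a) * dPow β := by
    noncomm_ring
  rw [AddMonoidHom.sub_apply, AddMonoidHom.coe_mulLeft, AddMonoidHom.mulRight_apply, key]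
  refine add_mem (ofPoly_mul_mem _ (orderSubgroup_mono ?_ (commutator_dPow_mem β hQ)))
    (orderSubgroup_mono ?_ (orderSubgroup_mul_mem (commutator_ofPoly_mem a hQ) (dPow_mem β)))
  all_goals omega

theorem orderSubgroup_exhaustive (P : WeylAlgebra n) : ∃ k : ℕ, P ∈ orderSubgroup n k := by
  let S : Subalgebra ℂ (WeylAlgebra n) :=
    { carrier := {P | ∃ k : ℕ, P ∈ orderSubgroup n k}
      mul_mem' := fun {a b} ⟨k, hk⟩ ⟨l, hl⟩ ↦ ⟨k + l, by
        exact_mod_cast orderSubgroup_mul_mem hk hl⟩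
      add_mem' := fun {a b} ⟨k, hk⟩ ⟨l, hl⟩ ↦ ⟨k + l,
        add_mem (orderSubgroup_mono (by simp) hk) (orderSubgroup_mono (by simp) hl)⟩
      algebraMap_mem' := fun r ↦ ⟨0, by
        rw [← (ofPoly n).commutes r]
        exact ofPoly_mem _⟩ }
  have hS : S = ⊤ := subalgebra_eq_top S (fun i ↦ ⟨0, x_mem i⟩) (fun i ↦ ⟨1, d_mem i⟩)
  exact (hS ▸ Algebra.mem_top : P ∈ S)

/-! ### Operators and their total symbols. -/

/-- `op` as an additive map. -/
noncomputable def opHom (n : ℕ) : SymbolRing n →+ WeylAlgebra n where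
  toFun := op
  map_zero' := by simp [op]
  map_add' p q := by
    have h (p : SymbolRing n) (s : Finset (Fin n →₀ ℕ)) (hs : p.support ⊆ s) :
        op p = ∑ β ∈ s, ofPoly n (p.coeff β) * ofConst n (MvPolynomial.monomial β 1) :=
      Finset.sum_subset hs fun β _ hβ ↦ by
        rw [MvPolynomial.notMem_support_iff.mp hβ, map_zero, zero_mul]
    classical
    rw [h (p + q) (p.support ∪ q.support) MvPolynomial.support_add,
      h p _ Finset.subset_union_left, h q _ Finset.subset_union_right, ← Finset.sum_add_distrib]
    simp only [MvPolynomial.coeff_add, map_add, add_mul]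

theorem op_monomial (β : Fin n →₀ ℕ) (a : MvPolynomial (Fin n) ℂ) :
    op (MvPolynomial.monomial β a) = ofPoly n a * dPow β := by
  classical
  rw [op, MvPolynomial.support_monomial]
  split_ifs with h
  · simp [h]
  · simp [dPow]

theorem op_C (a : MvPolynomial (Fin n) ℂ) : op (MvPolynomial.C a) = ofPoly n a := by
  simpa using op_monomial (n := n) 0 a

theorem op_C_mul_X (a : MvPolynomial (Fin n) ℂ) (i : Fin n) :
    op (MvPolynomial.C a * MvPolynomial.X i) = ofPoly n a * d i := by
  simpa [MvPolynomial.X, MvPolynomial.C_mul_monomial] using op_monomial (Finsupp.single i 1) a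

theorem op_C_mul_X_mul_X (a : MvPolynomial (Fin n) ℂ) (i j : Fin n) :
    op (MvPolynomial.C a * (MvPolynomial.X i * MvPolynomial.X j)) =
      ofPoly n a * (d i * d j) := by
  rw [← dPow_single, ← dPow_single, ← dPow_add, ← op_monomial, MvPolynomial.X, MvPolynomial.X,
    MvPolynomial.monomial_mul, MvPolynomial.C_mul_monomial, mul_one, mul_one]

theorem op_mem {p : SymbolRing n} {k : ℕ} (h : p.totalDegree ≤ k) :
    op p ∈ orderSubgroup n k :=
  sum_mem fun β hβ ↦ ofPoly_mul_dPow_mem (β := β) _ (by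
    exact_mod_cast (MvPolynomial.le_totalDegree hβ).trans h)

theorem orderFiltration_eq (k : ℕ) :
    orderFiltration n k = (orderSubgroup n k : Set (WeylAlgebra n)) := by
  ext P
  constructor
  · rintro ⟨p, hp, rfl⟩
    exact op_mem hp
  · let H : AddSubgroup (WeylAlgebra n) :=
      { carrier := orderFiltration n k
        zero_mem' := ⟨0, by simp, map_zero (opHom n)⟩
        add_mem' := by
          rintro _ _ ⟨p, hp, rfl⟩ ⟨q, hq, rfl⟩
          exact ⟨p + q, (MvPolynomial.totalDegree_add p q).trans (max_le hp hq),
            map_add (opHom n) p q⟩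
        neg_mem' := by
          rintro _ ⟨p, hp, rfl⟩
          exact ⟨-p, by rwa [MvPolynomial.totalDegree_neg], map_neg (opHom n) p⟩ }
    refine fun hP ↦ (orderSubgroup_induction (H := H) (fun a β hβ ↦ ?_) hP : P ∈ H)
    exact ⟨MvPolynomial.monomial β a, (MvPolynomial.totalDegree_monomial_le β a).trans
      (by exact_mod_cast hβ), op_monomial β a⟩

/-! ### Good filtrations and symbols for cyclic modules. -/

/-- The filtration of a cyclic module `D / J` induced by the order filtration. -/
noncomputable def cyclicFiltration (J : Ideal (WeylAlgebra n)) (j : ℤ) :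
    AddSubgroup (WeylAlgebra n ⧸ J) :=
  (orderSubgroup n j).map J.mkQ.toAddMonoidHom

theorem cyclicFiltration_smul_mem {J : Ideal (WeylAlgebra n)} {i j : ℤ} {P : WeylAlgebra n}
    {m : WeylAlgebra n ⧸ J} (hP : P ∈ orderSubgroup n i) (hm : m ∈ cyclicFiltration J j) :
    P • m ∈ cyclicFiltration J (j + i) := by
  obtain ⟨Q, hQ, rfl⟩ := hm
  exact ⟨P * Q, add_comm i j ▸ orderSubgroup_mul_mem hP hQ, J.mkQ.map_smul P Q⟩

theorem cyclicFiltration_le {J : Ideal (WeylAlgebra n)} {j : ℤ}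
    {H : AddSubgroup (WeylAlgebra n ⧸ J)}
    (h : ∀ a β, ((Finsupp.degree β : ℕ) : ℤ) ≤ j → ofPoly n a • J.mkQ (dPow β) ∈ H) :
    cyclicFiltration J j ≤ H := by
  rw [cyclicFiltration, AddSubgroup.map_le_iff_le_comap]
  refine orderSubgroup_induction fun a β hβ ↦ ?_
  change J.mkQ (ofPoly n a • dPow β) ∈ H
  rw [map_smul]
  exact h a β hβ

theorem isGoodFiltration_cyclicFiltration (J : Ideal (WeylAlgebra n)) :
    IsGoodFiltration n (cyclicFiltration J) where
  mono _ _ h := AddSubgroup.map_mono (orderSubgroup_mono h)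
  bounded_below := ⟨-1, fun k hk ↦ by
    rw [cyclicFiltration, orderSubgroup_of_neg (by omega), AddSubgroup.map_bot]⟩
  exhaustive m := by
    obtain ⟨P, rfl⟩ := J.mkQ_surjective m
    obtain ⟨k, hk⟩ := orderSubgroup_exhaustive P
    exact ⟨k, P, hk, rfl⟩
  smul_mem i j P hP m hm := by
    rw [orderFiltration_eq] at hP
    exact cyclicFiltration_smul_mem hP hm
  finite k := by
    classical
    have hfin : {β : Fin n →₀ ℕ | ((Finsupp.degree β : ℕ) : ℤ) ≤ k}.Finite :=
      (Finsupp.finite_of_degree_le k.toNat).subset fun β hβ ↦ by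
        simp only [Set.mem_ofPred_eq] at hβ ⊢
        omega
    refine ⟨hfin.toFinset.image fun β ↦ J.mkQ (dPow β), le_antisymm
      (cyclicFiltration_le fun a β hβ ↦ AddSubgroup.subset_closure ⟨a, _,
        Finset.mem_image_of_mem _ (hfin.mem_toFinset.mpr hβ), rfl⟩) ?_⟩
    rw [AddSubgroup.closure_le]
    rintro m ⟨a, s, hs, rfl⟩
    obtain ⟨β, hβ, rfl⟩ := Finset.mem_image.mp hs
    exact ⟨ofPoly n a * dPow β, ofPoly_mul_dPow_mem a (hfin.mem_toFinset.mp hβ),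
      J.mkQ.map_smul _ _⟩
  generated := by
    refine ⟨0, fun k hk i ↦ le_antisymm (cyclicFiltration_le fun a β hβ ↦ ?_) ?_⟩
    · apply AddSubgroup.subset_closure
      rw [orderFiltration_eq]
      -- Split β = γ + δ with |γ| = min(|β|, i). Then |δ| ≤ k: it is |β| - i if |β| ≥ i, and 0
      -- otherwise, where k ≥ 0 is needed.
      obtain ⟨γ, hγβ, hγ⟩ := β.exists_le_degree_eq (min β.degree i) (min_le_left _ _)
      obtain ⟨δ, rfl⟩ := exists_add_of_le hγβ
      rw [map_add] at hβ hγ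
      refine ⟨ofPoly n a * dPow γ, ofPoly_mul_dPow_mem _ (by omega), J.mkQ (dPow δ),
        ⟨_, orderSubgroup_mono (by omega) (dPow_mem δ), rfl⟩, ?_⟩
      rw [dPow_add, mul_smul, ← smul_eq_mul (dPow γ), map_smul]
    · rw [AddSubgroup.closure_le]
      rintro m ⟨P, hP, u, hu, rfl⟩
      rw [orderFiltration_eq] at hP
      exact cyclicFiltration_smul_mem hP hu

/-- For P in J, the product QP lies in J, so P acts on the class of Q as the commutator PQ - QP,
whose order is one lower than that of a general product. -/
theorem homogeneousComponent_mem_charIdeal {J : Ideal (WeylAlgebra n)} {k : ℕ}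
    {p : SymbolRing n} (hp : p.totalDegree ≤ k) (hJ : op p ∈ J) :
    MvPolynomial.homogeneousComponent k p ∈ charIdeal n (cyclicFiltration J) := by
  refine Ideal.subset_span ⟨k, p, hp, ?_, rfl⟩
  rintro j _ ⟨Q, hQ, rfl⟩
  refine ⟨op p * Q - Q * op p, ?_, ?_⟩
  · rw [add_comm j]
    exact commutator_mem (op_mem hp) hQ
  · have h0 : J.mkQ (Q * op p) = 0 :=
      (Submodule.Quotient.mk_eq_zero J).mpr (J.mul_mem_left Q hJ)
    change J.mkQ _ = op p • J.mkQ Q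
    rw [map_sub, h0, sub_zero, ← smul_eq_mul, map_smul]

end WeylAlgebra

/-! ### Representations of the Weyl algebra from integrable connections. -/

namespace WeylAlgebra

section Lift

variable {n : ℕ} {A : Type*} [Ring A] [Algebra ℂ A]

/-- The universal property of the Weyl algebra. -/
noncomputable def lift (X D : Fin n → A) (hX : ∀ i j, X i * X j = X j * X i)
    (hD : ∀ i j, D i * D j = D j * D i)
    (hDX : ∀ i j, D i * X j = X j * D i + if i = j then 1 else 0) : WeylAlgebra n →ₐ[ℂ] A :=
  RingQuot.liftAlgHom ℂ ⟨FreeAlgebra.lift ℂ (Sum.elim X D), by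
    intro a b h
    cases h with
    | x_comm i j => simpa using hX i j
    | d_comm i j => simpa using hD i j
    | leibniz i j =>
      rw [map_add, map_mul, map_mul, apply_ite (FreeAlgebra.lift ℂ (Sum.elim X D))]
      simpa using hDX i j⟩

variable (X D : Fin n → A) (hX : ∀ i j, X i * X j = X j * X i)
  (hD : ∀ i j, D i * D j = D j * D i)
  (hDX : ∀ i j, D i * X j = X j * D i + if i = j then 1 else 0)

@[simp]
theorem lift_x (i : Fin n) : lift X D hX hD hDX (x i) = X i := by
  refine (RingQuot.liftAlgHom_mkAlgHom_apply ℂ _ _ _).trans ?_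
  simp

@[simp]
theorem lift_d (i : Fin n) : lift X D hX hD hDX (d i) = D i := by
  refine (RingQuot.liftAlgHom_mkAlgHom_apply ℂ _ _ _).trans ?_
  simp

end Lift

section Derivation

variable {R K : Type*} [CommRing R] [IsDomain R] [Algebra ℂ R] [Field K] [Algebra ℂ K]
  [Algebra R K] [IsScalarTower ℂ R K] [IsFractionRing R K]

/-- Every derivation extends to the fraction field. -/
theorem exists_derivation_fractionRing (δ : Derivation ℂ R R) :
    ∃ δ' : Derivation ℂ K K, ∀ a, δ' (algebraMap R K a) = algebraMap R K (δ a) := by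
  -- The map a ↦ a + δ(a)ε is a ring homomorphism exactly because δ is a derivation. It sends
  -- nonzero a to units, so it extends to K; the ε-part of the extension is the derivation sought.
  let f : R →ₐ[ℂ] DualNumber K :=
    { toFun := fun a ↦ TrivSqZeroExt.inl (algebraMap R K a) +
        TrivSqZeroExt.inr (algebraMap R K (δ a))
      map_one' := by ext <;> simp
      map_zero' := by ext <;> simp
      map_mul' := fun a b ↦ by
        ext <;> simp [Algebra.smul_def, TrivSqZeroExt.algebraMap_eq_inl, mul_comm]
      map_add' := fun a b ↦ by ext <;> simp [Algebra.smul_def]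
      commutes' := fun r ↦ by
        ext <;> simp [← IsScalarTower.algebraMap_apply, TrivSqZeroExt.algebraMap_eq_inl'] }
  have hf : ∀ y : nonZeroDivisors R, IsUnit (f y) := fun y ↦ by
    rw [TrivSqZeroExt.isUnit_iff_isUnit_fst]
    simp [f]
  let g : K →ₐ[ℂ] DualNumber K := IsLocalization.liftAlgHom (M := nonZeroDivisors R) hf
  have hg (a : R) : g (algebraMap R K a) = f a :=
    IsLocalization.lift_eq (M := nonZeroDivisors R) _ a
  have hfst (z : K) : (g z).fst = z := by
    have : (TrivSqZeroExt.fstHom ℂ K K).comp g = AlgHom.id ℂ K :=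
      IsLocalization.algHom_ext (nonZeroDivisors R) (by
        ext a
        change (g (algebraMap R K a)).fst = algebraMap R K a
        simp [hg, f])
    exact DFunLike.congr_fun this z
  refine ⟨Derivation.mk' ((TrivSqZeroExt.sndHom K K).restrictScalars ℂ ∘ₗ g.toLinearMap)
    fun a b ↦ ?_, fun a ↦ ?_⟩
  · simp [hfst, mul_comm]
  · simp [hg, f, Algebra.smul_def, TrivSqZeroExt.algebraMap_eq_inl]

end Derivation

theorem derivation_fractionRing_ext {R K : Type*} [CommRing R] [Field K] [Algebra ℂ K]
    [Algebra R K] [IsFractionRing R K] {δ₁ δ₂ : Derivation ℂ K K}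
    (h : ∀ a, δ₁ (algebraMap R K a) = δ₂ (algebraMap R K a)) : δ₁ = δ₂ := by
  ext z
  obtain ⟨a, b, hb, rfl⟩ := IsFractionRing.div_surjective (A := R) z
  rw [Derivation.leibniz_div, Derivation.leibniz_div, h, h]

/-- The extension of `∂/∂x_i` to rational functions. -/
noncomputable def ratDeriv {n : ℕ} (i : Fin n) :
    Derivation ℂ (FractionRing (MvPolynomial (Fin n) ℂ))
      (FractionRing (MvPolynomial (Fin n) ℂ)) :=
  (exists_derivation_fractionRing (MvPolynomial.pderiv i)).choose

theorem ratDeriv_algebraMap {n : ℕ} (i : Fin n) (a : MvPolynomial (Fin n) ℂ) :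
    ratDeriv i (algebraMap _ _ a) = algebraMap _ _ (MvPolynomial.pderiv i a) :=
  (exists_derivation_fractionRing (MvPolynomial.pderiv i)).choose_spec a

/-- The bracket of two derivations is a derivation, and a derivation of the fraction field is
determined on polynomials, where partial derivatives commute. -/
theorem ratDeriv_comm {n : ℕ} (i j : Fin n) (z : FractionRing (MvPolynomial (Fin n) ℂ)) :
    ratDeriv i (ratDeriv j z) = ratDeriv j (ratDeriv i z) := by
  have h : ⁅ratDeriv i, ratDeriv j⁆ = (0 : Derivation ℂ
      (FractionRing (MvPolynomial (Fin n) ℂ)) (FractionRing (MvPolynomial (Fin n) ℂ))) := by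
    refine derivation_fractionRing_ext (R := MvPolynomial (Fin n) ℂ) fun a ↦ ?_
    have h' : (⁅MvPolynomial.pderiv (R := ℂ) i, MvPolynomial.pderiv (R := ℂ) j⁆ :
        Derivation ℂ (MvPolynomial (Fin n) ℂ) (MvPolynomial (Fin n) ℂ)) =
        (0 : Derivation ℂ (MvPolynomial (Fin n) ℂ) (MvPolynomial (Fin n) ℂ)) := by
      refine MvPolynomial.derivation_ext fun k ↦ ?_
      simp [Derivation.commutator_apply, MvPolynomial.pderiv_X, Pi.single_apply, apply_ite]
    have h'' := DFunLike.congr_fun h' a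
    rw [Derivation.commutator_apply] at h'' ⊢
    simp only [ratDeriv_algebraMap, ← map_sub, h'']
    simp
  simpa [Derivation.commutator_apply, sub_eq_zero] using DFunLike.congr_fun h z

section Connection

variable {K ι : Type*} [Field K] [Algebra ℂ K] [Fintype ι]

/-- The operator `v ↦ δ v + A v` on vectors over a differential field. -/
noncomputable def connection (δ : Derivation ℂ K K) (A : Matrix ι ι K) :
    Module.End ℂ (ι → K) :=
  δ.toLinearMap.compLeft ι + A.mulVecLin.restrictScalars ℂ

theorem connection_apply (δ : Derivation ℂ K K) (A : Matrix ι ι K) (v : ι → K) (k : ι) :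
    connection δ A v k = δ (v k) + ∑ l, A k l * v l := rfl

theorem connection_smul (δ : Derivation ℂ K K) (A : Matrix ι ι K) (z : K) (v : ι → K) :
    connection δ A (z • v) = z • connection δ A v + δ z • v := by
  ext k
  simp only [connection_apply, Pi.add_apply, Pi.smul_apply, smul_eq_mul, Derivation.leibniz,
    mul_add, Finset.mul_sum, mul_left_comm (A k _)]
  ring

/-- The hypothesis `h` is the vanishing of the curvature δB - δ'A + [A, B]. -/
theorem connection_comm {δ δ' : Derivation ℂ K K} {A B : Matrix ι ι K}
    (hδ : ∀ z, δ (δ' z) = δ' (δ z))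
    (h : ∀ k l, δ (B k l) + (A * B) k l = δ' (A k l) + (B * A) k l) :
    connection δ A * connection δ' B = connection δ' B * connection δ A := by
  ext v k
  have h1 : ∑ l, (δ (B k l) + (A * B) k l) * v l = ∑ l, (δ' (A k l) + (B * A) k l) * v l := by
    simp only [h]
  have h2 (A B : Matrix ι ι K) : ∑ l, (A * B) k l * v l = ∑ l, A k l * ∑ m, B l m * v m := by
    simp only [Matrix.mul_apply, Finset.sum_mul, Finset.mul_sum, mul_assoc]
    exact Finset.sum_comm
  simp only [add_mul, Finset.sum_add_distrib, h2] at h1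
  simp only [Module.End.mul_apply, connection_apply, map_add, map_sum, mul_add,
    Finset.sum_add_distrib, Derivation.leibniz, smul_eq_mul, hδ]
  simp only [mul_comm (v _)]
  linear_combination h1

end Connection

end WeylAlgebra

/-! ### The Pearcey connection. -/

namespace Pearcey

open WeylAlgebra

section Matrices

variable {K : Type*} [Field K] (a b e : K)

/-- The connection matrices of the Pearcey system in the basis `1, ∂₁, ∂₂`, where `a, b, e` are
the coordinates. -/
def connectionMatrix : Fin 3 → Matrix (Fin 3) (Fin 3) K :=
  -- Columns hold the coordinates of ∂_i·1, ∂_i∂₁, ∂_i∂₂ modulo the ideal. In the last matrix, ∂_η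
  -- is (3x₁∂₁ + 2x₂∂₂ - 1)/(4η) by P₄, and the other columns follow by applying ∂₁ and ∂₂ to this
  -- and reducing.
  ![!![0, 0, -(e ^ 2 * a) / 4; 1, 0, -(e * b) / 2; 0, e, 0],
    !![0, -(e ^ 2 * a) / 4, -e / 4; 0, -(e * b) / 2, -(e * a) / 4; 1, 0, -(e * b) / 2],
    !![-1 / (4 * e), -(e * a * b) / 8, -(3 * e * a ^ 2) / 16 - b / 8;
      3 * a / (4 * e), 2 / (4 * e) - b ^ 2 / 4, -(a * b) / 2;
      2 * b / (4 * e), 3 * a / 4, 1 / (4 * e) - b ^ 2 / 4]]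

variable [CharZero K] [Algebra ℂ K] {a b e}

theorem connectionMatrix_integrable (he : e ≠ 0) (δ : Fin 3 → Derivation ℂ K K)
    (ha : ∀ i, δ i a = if i = 0 then 1 else 0) (hb : ∀ i, δ i b = if i = 1 then 1 else 0)
    (hη : ∀ i, δ i e = if i = 2 then 1 else 0) (i j k l : Fin 3) :
    δ i (connectionMatrix a b e j k l) +
        (connectionMatrix a b e i * connectionMatrix a b e j) k l =
      δ j (connectionMatrix a b e i k l) +
        (connectionMatrix a b e j * connectionMatrix a b e i) k l := by
  have hnum (i : Fin 3) (n : ℕ) [n.AtLeastTwo] : δ i (OfNat.ofNat n : K) = 0 :=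
    (δ i).map_natCast n
  wlog hij : i < j generalizing i j
  · rcases (not_lt.mp hij).eq_or_lt with rfl | h
    · rfl
    · exact (this j i h).symm
  fin_cases i <;> fin_cases j <;> first | exact absurd hij (by decide) | skip
  all_goals
    fin_cases k <;> fin_cases l <;>
    simp [connectionMatrix, Matrix.mul_apply, Fin.sum_univ_three, Derivation.leibniz_div,
      Derivation.leibniz_inv, one_div, neg_div,
      Derivation.leibniz, Derivation.leibniz_pow, ha, hb, hη, hnum] <;>
    field_simp <;> ring

end Matrices

/-- The field of rational functions in the three coordinates. -/
abbrev RatField : Type := FractionRing (MvPolynomial (Fin 3) ℂ)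

/-- The coordinates as rational functions. -/
noncomputable def coord (i : Fin 3) : RatField :=
  algebraMap (MvPolynomial (Fin 3) ℂ) RatField (MvPolynomial.X i)

theorem coord_ne_zero (i : Fin 3) : coord i ≠ 0 := by simp [coord]

theorem ratDeriv_coord (i j : Fin 3) : ratDeriv i (coord j) = if i = j then 1 else 0 := by
  simp [coord, ratDeriv_algebraMap, MvPolynomial.pderiv_X, Pi.single_apply, apply_ite, eq_comm]

/-- The operators `∂_i` of the Pearcey connection. -/
noncomputable def conn (i : Fin 3) : Module.End ℂ (Fin 3 → RatField) :=
  connection (ratDeriv i) (connectionMatrix (coord 0) (coord 1) (coord 2) i)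

/-- The Pearcey connection as a representation of the Weyl algebra. -/
noncomputable def rep : WeylAlgebra 3 →ₐ[ℂ] Module.End ℂ (Fin 3 → RatField) :=
  WeylAlgebra.lift (fun i ↦ Algebra.lsmul ℂ ℂ (Fin 3 → RatField) (coord i)) conn
    (fun i j ↦ by rw [← map_mul, ← map_mul, mul_comm])
    (fun i j ↦ connection_comm (ratDeriv_comm i j)
      (connectionMatrix_integrable (coord_ne_zero 2) ratDeriv (fun i ↦ ratDeriv_coord i 0)
        (fun i ↦ ratDeriv_coord i 1) (fun i ↦ ratDeriv_coord i 2) i j))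
    (fun i j ↦ LinearMap.ext fun v ↦ by
      refine (connection_smul _ _ (coord j) v).trans ?_
      rw [ratDeriv_coord]
      split_ifs <;> simp [conn])

theorem rep_x (i : Fin 3) (v : Fin 3 → RatField) : rep (x i) v = coord i • v := by
  exact LinearMap.congr_fun (lift_x _ _ _ _ _ i) v

theorem rep_d (i : Fin 3) : rep (d i) = conn i := lift_d _ _ _ _ _ i

theorem rep_ofPoly (a : MvPolynomial (Fin 3) ℂ) (v : Fin 3 → RatField) :
    rep (ofPoly 3 a) v = a • v := by
  have h : rep.comp (ofPoly 3) = Algebra.lsmul ℂ ℂ (Fin 3 → RatField) :=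
    MvPolynomial.algHom_ext fun i ↦ LinearMap.ext fun v ↦ by
      rw [AlgHom.comp_apply, ofPoly_X, rep_x]
      exact algebraMap_smul _ _ _
  exact LinearMap.congr_fun (DFunLike.congr_fun h a) v

theorem conn_apply_zero (v : Fin 3 → RatField) : conn 0 v =
    ![ratDeriv 0 (v 0) + -(coord 2 ^ 2 * coord 0) / 4 * v 2,
      ratDeriv 0 (v 1) + (v 0 + -(coord 2 * coord 1) / 2 * v 2),
      ratDeriv 0 (v 2) + coord 2 * v 1] := by
  ext k
  fin_cases k <;> simp [conn, connection_apply, connectionMatrix, Fin.sum_univ_three]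

theorem conn_apply_one (v : Fin 3 → RatField) : conn 1 v =
    ![ratDeriv 1 (v 0) + (-(coord 2 ^ 2 * coord 0) / 4 * v 1 + -coord 2 / 4 * v 2),
      ratDeriv 1 (v 1) + (-(coord 2 * coord 1) / 2 * v 1 + -(coord 2 * coord 0) / 4 * v 2),
      ratDeriv 1 (v 2) + (v 0 + -(coord 2 * coord 1) / 2 * v 2)] := by
  ext k
  fin_cases k <;> simp [conn, connection_apply, connectionMatrix, Fin.sum_univ_three]

theorem conn_two_single : conn 2 ![1, 0, 0] =
    ![-1 / (4 * coord 2), 3 * coord 0 / (4 * coord 2), 2 * coord 1 / (4 * coord 2)] := by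
  ext k
  fin_cases k <;> simp [conn, connection_apply, connectionMatrix, Fin.sum_univ_three]

theorem conn_zero_single : conn 0 ![1, 0, 0] = ![0, 1, 0] := by
  simp [conn_apply_zero]

theorem conn_one_single : conn 1 ![1, 0, 0] = ![0, 0, 1] := by
  simp [conn_apply_one]

/-- Evaluation of operators at the cyclic vector. -/
noncomputable def evalCyclic :
    WeylAlgebra 3 →ₛₗ[rep.toRingHom] (Fin 3 → RatField) where
  toFun P := rep P ![1, 0, 0]
  map_add' P Q := by rw [map_add, LinearMap.add_apply]
  map_smul' P Q := by
    rw [smul_eq_mul, map_mul]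
    rfl

theorem evalCyclic_apply (P : WeylAlgebra 3) : evalCyclic P = rep P ![1, 0, 0] := rfl

theorem I_le_ker : I ≤ evalCyclic.ker := by
  have h := coord_ne_zero 2
  rw [I, Ideal.span, Submodule.span_le]
  rintro P (rfl | rfl | rfl | rfl)
  all_goals
    rw [SetLike.mem_coe, LinearMap.mem_ker, evalCyclic_apply]
    simp only [P₁, P₂, P₃, P₄, x₁, x₂, η, d₁, d₂, dη, map_add, map_sub, map_mul, pow_two,
      LinearMap.add_apply, LinearMap.sub_apply, Module.End.mul_apply, rep_x, rep_d,
      conn_two_single, map_ofNat, map_one,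
      Module.End.one_apply, Module.End.ofNat_apply, conn_apply_zero, conn_apply_one]
    ext k
    fin_cases k <;> simp [← Nat.cast_smul_eq_nsmul RatField] <;> field_simp <;> ring

/-- The `D`-linear map from the Pearcey module to the connection. -/
noncomputable def toConnection : (WeylAlgebra 3 ⧸ I) →ₛₗ[rep.toRingHom] (Fin 3 → RatField) :=
  I.liftQ evalCyclic I_le_ker

theorem toConnection_ofPoly_smul (a : MvPolynomial (Fin 3) ℂ) (m : WeylAlgebra 3 ⧸ I) :
    toConnection (ofPoly 3 a • m) = a • toConnection m := by
  rw [map_smulₛₗ]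
  exact rep_ofPoly a _

end Pearcey

/-! ### The rank: generation by 1, ∂₁, ∂₂ after inverting η, and independence. -/

namespace WeylAlgebra

/-- The `ℂ[x]`-module underlying a cyclic `D`-module. -/
noncomputable abbrev polyModule {n : ℕ} (J : Ideal (WeylAlgebra n)) :
    Module (MvPolynomial (Fin n) ℂ) (WeylAlgebra n ⧸ J) :=
  Module.compHom _ (ofPoly n).toRingHom

attribute [local instance] polyModule

theorem poly_smul_eq {n : ℕ} {J : Ideal (WeylAlgebra n)} (a : MvPolynomial (Fin n) ℂ)
    (m : WeylAlgebra n ⧸ J) : a • m = ofPoly n a • m := rfl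

theorem mkQ_mul {n : ℕ} {J : Ideal (WeylAlgebra n)} (P Q : WeylAlgebra n) :
    J.mkQ (P * Q) = P • J.mkQ Q := J.mkQ.map_smul P Q

end WeylAlgebra

namespace Pearcey

open WeylAlgebra MvPolynomial

attribute [local instance] polyModule

/-- The classes of `1, ∂₁, ∂₂` in the Pearcey module. -/
noncomputable def gen : Fin 3 → WeylAlgebra 3 ⧸ I := fun j ↦ I.mkQ (![1, d 0, d 1] j)

/-- The polynomial span of `1, ∂₁, ∂₂` in the Pearcey module. -/
noncomputable def genSpan : Submodule (MvPolynomial (Fin 3) ℂ) (WeylAlgebra 3 ⧸ I) :=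
  Submodule.span _ (Set.range gen)

theorem gen_mem (j : Fin 3) : gen j ∈ genSpan := Submodule.subset_span ⟨j, rfl⟩

theorem mkQ_mem_genSpan {P Q : WeylAlgebra 3} (c : Fin 3 → MvPolynomial (Fin 3) ℂ) (hQ : Q ∈ I)
    (h : P = ofPoly 3 (c 0) + ofPoly 3 (c 1) * d 0 + ofPoly 3 (c 2) * d 1 + Q) :
    I.mkQ P ∈ genSpan := by
  have h0 : I.mkQ Q = 0 := (Submodule.Quotient.mk_eq_zero I).mpr hQ
  have h1 : I.mkQ P = c 0 • gen 0 + c 1 • gen 1 + c 2 • gen 2 := by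
    rw [h, map_add, h0, add_zero, map_add, map_add, mkQ_mul, mkQ_mul,
      ← mul_one (ofPoly 3 (c 0)), mkQ_mul]
    rfl
  rw [h1]
  exact add_mem (add_mem (genSpan.smul_mem _ (gen_mem 0)) (genSpan.smul_mem _ (gen_mem 1)))
    (genSpan.smul_mem _ (gen_mem 2))

theorem mem_of_four_mul_mem {P : WeylAlgebra 3} (h : I.mkQ (4 * P) ∈ genSpan) :
    I.mkQ P ∈ genSpan := by
  have h4 : ofPoly 3 (C (1 / 4)) * (4 * P) = P := by
    rw [← mul_assoc, ← map_ofNat (ofPoly 3) 4, ← map_mul, ← map_ofNat C 4, ← C_mul]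
    norm_num
  rw [← h4, mkQ_mul]
  exact genSpan.smul_mem _ h

theorem P₁_mem : P₁ ∈ I := Ideal.subset_span (by simp)
theorem P₂_mem : P₂ ∈ I := Ideal.subset_span (by simp)
theorem P₃_mem : P₃ ∈ I := Ideal.subset_span (by simp)
theorem P₄_mem : P₄ ∈ I := Ideal.subset_span (by simp)

/-- P₃, P₁ and P₂ are solved for ∂₁², ∂₁∂₂ and ∂₂² respectively; the coefficient 4 is a unit. Only
the directions x₁, x₂ occur, where no division by η is needed. -/
theorem mkQ_d_mul_d_mem : ∀ i j : Fin 2, I.mkQ (d i.castSucc * d j.castSucc) ∈ genSpan := by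
  have h01 : I.mkQ (d 0 * d 1) ∈ genSpan := by
    apply mem_of_four_mul_mem
    refine mkQ_mem_genSpan ![-(X 2 ^ 2 * X 0), -(2 * X 2 * X 1), 0] P₁_mem ?_
    simp [P₁, x₁, x₂, η, d₁, d₂, map_ofNat (ofPoly 3)]
    noncomm_ring
  intro i j
  fin_cases i <;> fin_cases j
  · refine mkQ_mem_genSpan ![0, 0, X 2] (I.neg_mem P₃_mem) ?_
    simp [P₃, η, d₁, d₂]
    noncomm_ring
  · exact h01
  · change I.mkQ (d 1 * d 0) ∈ genSpan
    rwa [d_mul_d]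
  · apply mem_of_four_mul_mem
    refine mkQ_mem_genSpan ![-X 2, -(X 2 * X 0), -(2 * X 2 * X 1)] P₂_mem ?_
    simp [P₂, x₁, x₂, η, d₁, d₂, map_ofNat (ofPoly 3)]
    noncomm_ring

/-- By the Leibniz rule `hL`, stability of the span need only be tested on its generators. -/
theorem smul_mem_genSpan {L : WeylAlgebra 3}
    (δ : MvPolynomial (Fin 3) ℂ → MvPolynomial (Fin 3) ℂ)
    (hL : ∀ a, L * ofPoly 3 a = ofPoly 3 a * L + ofPoly 3 (δ a))
    (h : ∀ j, L • gen j ∈ genSpan) {m : WeylAlgebra 3 ⧸ I} (hm : m ∈ genSpan) :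
    L • m ∈ genSpan := by
  induction hm using Submodule.span_induction with
  | mem m hm =>
    obtain ⟨j, rfl⟩ := hm
    exact h j
  | zero => simp
  | add m m' _ _ ih ih' =>
    rw [smul_add]
    exact add_mem ih ih'
  | smul a m hm ih =>
    rw [poly_smul_eq, ← mul_smul, hL, add_smul, mul_smul]
    exact add_mem (genSpan.smul_mem a ih) (genSpan.smul_mem (δ a) hm)

theorem d_smul_mem_genSpan (i : Fin 2) {m : WeylAlgebra 3 ⧸ I} (hm : m ∈ genSpan) :
    d i.castSucc • m ∈ genSpan := by
  refine smul_mem_genSpan _ (d_mul_ofPoly i.castSucc) (fun j ↦ ?_) hm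
  rw [gen, ← mkQ_mul]
  fin_cases j
  · change I.mkQ (_ * 1) ∈ _
    rw [mul_one]
    fin_cases i
    · exact gen_mem 1
    · exact gen_mem 2
  · exact mkQ_d_mul_d_mem i 0
  · exact mkQ_d_mul_d_mem i 1

/-- This reduces η∂_η on the class of ∂_i to ∂_i applied to the class of η∂_η, which P₄ expresses in
the span. -/
theorem eulerEta_commute (i : Fin 2) :
    (x 2 * d 2 : WeylAlgebra 3) * d i.castSucc = d i.castSucc * (x 2 * d 2) := by
  rw [← mul_assoc, d_mul_x, if_neg (by fin_cases i <;> decide), add_zero, mul_assoc, mul_assoc,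
    d_mul_d 2]

theorem eulerEta_smul_mem_genSpan {m : WeylAlgebra 3 ⧸ I} (hm : m ∈ genSpan) :
    (x 2 * d 2 : WeylAlgebra 3) • m ∈ genSpan := by
  have h0 : I.mkQ (x 2 * d 2) ∈ genSpan := by
    apply mem_of_four_mul_mem
    refine mkQ_mem_genSpan ![-1, 3 * X 0, 2 * X 1] (I.neg_mem P₄_mem) ?_
    simp [P₄, x₁, x₂, η, d₁, d₂, dη, map_ofNat (ofPoly 3)]
    noncomm_ring
  refine smul_mem_genSpan (fun a ↦ X 2 * pderiv 2 a) (fun a ↦ ?_) (fun j ↦ ?_) hm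
  · rw [mul_assoc, d_mul_ofPoly, mul_add, ← mul_assoc, ← ofPoly_X, ← map_mul, mul_comm (X 2),
      map_mul, map_mul, mul_assoc]
  · rw [gen, ← mkQ_mul]
    fin_cases j
    · change I.mkQ (_ * 1) ∈ _
      rwa [mul_one]
    · change I.mkQ (x 2 * d 2 * d (Fin.castSucc 0)) ∈ _
      rw [eulerEta_commute, mkQ_mul]
      exact d_smul_mem_genSpan 0 h0
    · change I.mkQ (x 2 * d 2 * d (Fin.castSucc 1)) ∈ _
      rw [eulerEta_commute, mkQ_mul]
      exact d_smul_mem_genSpan 1 h0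

theorem eta_d_smul_mem_genSpan (i : Fin 3) {m : WeylAlgebra 3 ⧸ I} (hm : m ∈ genSpan) :
    (x 2 * d i : WeylAlgebra 3) • m ∈ genSpan := by
  induction i using Fin.lastCases with
  | last => exact eulerEta_smul_mem_genSpan hm
  | cast i =>
    rw [mul_smul, ← ofPoly_X]
    exact genSpan.smul_mem _ (d_smul_mem_genSpan i hm)

theorem eta_pow_d_smul_mem_genSpan (i : Fin 3) (k : ℕ) {m : WeylAlgebra 3 ⧸ I}
    (hm : (X 2 ^ k : MvPolynomial (Fin 3) ℂ) • m ∈ genSpan) :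
    (X 2 ^ (k + 1) : MvPolynomial (Fin 3) ℂ) • (d i • m) ∈ genSpan := by
  have h1 : X 2 * pderiv i (X 2 ^ k) =
      (k : MvPolynomial (Fin 3) ℂ) * pderiv i (X 2) * X 2 ^ k := by
    rw [Derivation.leibniz_pow]
    cases k
    · simp
    · simp only [Nat.add_sub_cancel, smul_eq_mul, nsmul_eq_mul]
      ring
  -- The identity η^(k+1) ∂_i = (η∂_i) η^k - k (∂_i η) η^k, which puts η^k next to `m`.
  have h2 : ofPoly 3 (X 2 ^ (k + 1)) * d i = x 2 * d i * ofPoly 3 (X 2 ^ k) -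
      ofPoly 3 ((k : MvPolynomial (Fin 3) ℂ) * pderiv i (X 2)) * ofPoly 3 (X 2 ^ k) := by
    rw [← map_mul, ← h1, mul_assoc, d_mul_ofPoly, mul_add, ← ofPoly_X, ← map_mul,
      add_sub_cancel_right, ← mul_assoc, ← map_mul, pow_succ']
  rw [poly_smul_eq, ← mul_smul, h2, sub_smul, mul_smul, mul_smul _ (ofPoly 3 (X 2 ^ k))]
  exact sub_mem (eta_d_smul_mem_genSpan i hm) (genSpan.smul_mem _ hm)

theorem exists_eta_pow_smul_mem (m : WeylAlgebra 3 ⧸ I) :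
    ∃ k : ℕ, (X 2 ^ k : MvPolynomial (Fin 3) ℂ) • m ∈ genSpan := by
  have hpoly (a : MvPolynomial (Fin 3) ℂ) (m : WeylAlgebra 3 ⧸ I)
      (hm : ∃ k : ℕ, (X 2 ^ k : MvPolynomial (Fin 3) ℂ) • m ∈ genSpan) :
      ∃ k : ℕ, (X 2 ^ k : MvPolynomial (Fin 3) ℂ) • (ofPoly 3 a • m) ∈ genSpan := by
    obtain ⟨k, hk⟩ := hm
    refine ⟨k, ?_⟩
    rw [← poly_smul_eq, smul_comm]
    exact genSpan.smul_mem a hk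
  -- Operators preserving the elements that some power of η moves into the span. They form a
  -- subalgebra, so the generators of D suffice; applying it to the class of 1 gives all of M.
  let U : Subalgebra ℂ (WeylAlgebra 3) :=
    { carrier := {P | ∀ m : WeylAlgebra 3 ⧸ I,
        (∃ k : ℕ, (X 2 ^ k : MvPolynomial (Fin 3) ℂ) • m ∈ genSpan) →
          ∃ k : ℕ, (X 2 ^ k : MvPolynomial (Fin 3) ℂ) • (P • m) ∈ genSpan}
      mul_mem' := fun {P Q} hP hQ m hm ↦ by
        rw [mul_smul]
        exact hP _ (hQ m hm)
      add_mem' := fun {P Q} hP hQ m hm ↦ by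
        obtain ⟨k, hk⟩ := hP m hm
        obtain ⟨l, hl⟩ := hQ m hm
        refine ⟨k + l, ?_⟩
        rw [add_smul, smul_add]
        refine add_mem ?_ ?_
        · rw [pow_add, mul_comm, mul_smul]
          exact genSpan.smul_mem _ hk
        · rw [pow_add, mul_smul]
          exact genSpan.smul_mem _ hl
      algebraMap_mem' := fun r m hm ↦ by
        rw [← (ofPoly 3).commutes r]
        exact hpoly _ m hm }
  have hU : U = ⊤ := by
    refine subalgebra_eq_top U (fun i m hm ↦ ?_) (fun i m ⟨k, hk⟩ ↦ ?_)
    · rw [← ofPoly_X]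
      exact hpoly _ m hm
    · exact ⟨k + 1, eta_pow_d_smul_mem_genSpan i k hk⟩
  obtain ⟨P, rfl⟩ := I.mkQ_surjective m
  have hP : P ∈ U := hU ▸ Algebra.mem_top
  have := hP (gen 0) ⟨0, by simpa using gen_mem 0⟩
  rw [gen, ← mkQ_mul] at this
  simpa using this

/-- The classes of `1, ∂₁, ∂₂` in the localized Pearcey module. -/
noncomputable def ratGen (j : Fin 3) :
    RatField ⊗[MvPolynomial (Fin 3) ℂ] (WeylAlgebra 3 ⧸ I) := 1 ⊗ₜ gen j

theorem span_ratGen : ⊤ ≤ Submodule.span RatField (Set.range ratGen) := by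
  have hS {m : WeylAlgebra 3 ⧸ I} (hm : m ∈ genSpan) :
      (1 : RatField) ⊗ₜ[MvPolynomial (Fin 3) ℂ] m ∈
        Submodule.span RatField (Set.range ratGen) := by
    induction hm using Submodule.span_induction with
    | mem m hm =>
      obtain ⟨j, rfl⟩ := hm
      exact Submodule.subset_span ⟨j, rfl⟩
    | zero => simp
    | add m m' _ _ ih ih' =>
      rw [TensorProduct.tmul_add]
      exact add_mem ih ih'
    | smul a m _ ih =>
      rw [TensorProduct.tmul_smul, ← algebraMap_smul RatField a]
      exact Submodule.smul_mem _ _ ih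
  rintro t -
  induction t using TensorProduct.induction_on with
  | zero => exact zero_mem _
  | add s t hs ht => exact add_mem hs ht
  | tmul z m =>
    obtain ⟨k, hk⟩ := exists_eta_pow_smul_mem m
    have h := hS hk
    have hne : algebraMap (MvPolynomial (Fin 3) ℂ) RatField (X 2 ^ k) ≠ 0 := by simp
    rw [TensorProduct.tmul_smul, ← algebraMap_smul RatField, Submodule.smul_mem_iff _ hne] at h
    simpa [TensorProduct.smul_tmul'] using Submodule.smul_mem _ z h

/-- The base change of `toConnection` to rational functions. -/
noncomputable def ratToConnection :
    RatField ⊗[MvPolynomial (Fin 3) ℂ] (WeylAlgebra 3 ⧸ I) →ₗ[RatField] (Fin 3 → RatField) :=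
  LinearMap.liftBaseChange RatField
    { toFun := toConnection
      map_add' := map_add toConnection
      map_smul' := toConnection_ofPoly_smul }

theorem ratToConnection_ratGen (j : Fin 3) : ratToConnection (ratGen j) = Pi.single j 1 := by
  have h : ratToConnection (ratGen j) = rep (![1, d 0, d 1] j) ![1, 0, 0] := by
    rw [ratToConnection, ratGen, LinearMap.liftBaseChange_tmul, one_smul]
    rfl
  rw [h]
  fin_cases j <;> ext k <;> fin_cases k <;>
    simp [rep_d, conn_zero_single, conn_one_single]

/-- The images in K³ are the standard basis. -/
theorem linearIndependent_ratGen : LinearIndependent RatField ratGen := by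
  refine LinearIndependent.of_comp ratToConnection ?_
  convert (Pi.basisFun RatField (Fin 3)).linearIndependent using 1
  ext j : 1
  rw [Function.comp_apply, ratToConnection_ratGen, Pi.basisFun_apply]

theorem holonomicRank_eq : holonomicRank 3 (WeylAlgebra 3 ⧸ I) = 3 := by
  change Module.rank RatField (RatField ⊗[MvPolynomial (Fin 3) ℂ] (WeylAlgebra 3 ⧸ I)) = 3
  rw [rank_eq_card_basis (Module.Basis.mk linearIndependent_ratGen span_ratGen)]
  simp

end Pearcey

/-! ### Tools for characteristic ideals. -/

namespace WeylAlgebra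

open MvPolynomial

theorem mem_charIdeal_of_op_mem {n : ℕ} {J : Ideal (WeylAlgebra n)} {k : ℕ}
    {q r : SymbolRing n} (hq : q.IsHomogeneous k) (hr : r.totalDegree < k) (hJ : op (q + r) ∈ J) :
    q ∈ charIdeal n (cyclicFiltration J) := by
  have h := homogeneousComponent_mem_charIdeal
    ((totalDegree_add q r).trans (max_le hq.totalDegree_le hr.le)) hJ
  rwa [map_add, homogeneousComponent_eq_zero _ _ hr, homogeneousComponent_of_mem hq, if_pos rfl,
    add_zero] at h

theorem op_add {n : ℕ} (p q : SymbolRing n) : op (p + q) = op p + op q := map_add (opHom n) p q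

theorem isHomogeneous_C_mul_X_mul_X {n : ℕ} (a : MvPolynomial (Fin n) ℂ) (i j : Fin n) :
    (C a * (X i * X j) : SymbolRing n).IsHomogeneous 2 := by
  simpa using (isHomogeneous_C (Fin n) a).mul ((isHomogeneous_X _ i).mul (isHomogeneous_X _ j))

theorem totalDegree_C_mul_X_le {n : ℕ} (a : MvPolynomial (Fin n) ℂ) (i : Fin n) :
    (C a * X i : SymbolRing n).totalDegree ≤ 1 := by
  simpa using ((isHomogeneous_C (Fin n) a).mul (isHomogeneous_X _ i)).totalDegree_le

theorem ringKrullDim_polynomialRing : ringKrullDim (MvPolynomial (Fin 3) ℂ) = 3 := by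
  rw [MvPolynomial.ringKrullDim_of_isNoetherianRing, ringKrullDim_eq_zero_of_field]
  simp

/-- If the cyclic vector is not torsion, the characteristic variety contains the zero section. -/
theorem charIdeal_le_ker_constantCoeff {n : ℕ} {J : Ideal (WeylAlgebra n)}
    (h : ∀ a, ofPoly n a ∈ J → a = 0) :
    charIdeal n (cyclicFiltration J) ≤ RingHom.ker (constantCoeff (σ := Fin n)) := by
  rw [charIdeal, Ideal.span_le]
  rintro _ ⟨k, p, hp, hk, rfl⟩
  rw [SetLike.mem_coe, RingHom.mem_ker, constantCoeff_eq, coeff_homogeneousComponent]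
  split_ifs with h0
  · rw [map_zero] at h0
    subst h0
    obtain ⟨a, rfl⟩ : ∃ a, p = C a := ⟨_, totalDegree_eq_zero_iff_eq_C.mp (by omega)⟩
    -- Only k = 0 can give a nonzero constant coefficient. Then the class of a lies in step 0 + 0 -
    -- 1 = -1 of the filtration, which is zero, so a is in J.
    have h1 := hk 0 (J.mkQ 1) ⟨1, by simpa using ofPoly_mem (n := n) 1, rfl⟩
    rw [op_C, cyclicFiltration, orderSubgroup_of_neg (by simp), AddSubgroup.map_bot,
      AddSubgroup.mem_bot, ← map_smul, smul_eq_mul, mul_one] at h1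
    simpa using h a ((Submodule.Quotient.mk_eq_zero J).mp h1)
  · rfl

end WeylAlgebra

/-! ### The characteristic variety of the Pearcey module. -/

namespace Pearcey

open WeylAlgebra MvPolynomial

/-- The characteristic ideal of the Pearcey module. -/
noncomputable def charI : Ideal (SymbolRing 3) := charIdeal 3 (cyclicFiltration I)

theorem symbol_P₂_mem : (C 4 * (X 1 * X 1) : SymbolRing 3) ∈ charI := by
  refine mem_charIdeal_of_op_mem (k := 2)
    (r := C (X 2 * X 0) * X 0 + C (2 * X 2 * X 1) * X 1 + C (X 2))
    (isHomogeneous_C_mul_X_mul_X _ _ _) ?_ ?_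
  · refine ((totalDegree_add _ _).trans (max_le ((totalDegree_add _ _).trans (max_le
      (totalDegree_C_mul_X_le _ _) (totalDegree_C_mul_X_le _ _))) ?_)).trans_lt one_lt_two
    simp
  · simp only [op_add, op_C, op_C_mul_X, op_C_mul_X_mul_X]
    convert P₂_mem using 1
    simp [P₂, x₁, x₂, η, d₁, d₂, map_ofNat (ofPoly 3)]
    noncomm_ring

theorem symbol_P₃_mem : (C (-1) * (X 0 * X 0) : SymbolRing 3) ∈ charI := by
  refine mem_charIdeal_of_op_mem (k := 2) (r := C (X 2) * X 1)
    (isHomogeneous_C_mul_X_mul_X _ _ _) ((totalDegree_C_mul_X_le _ _).trans_lt one_lt_two) ?_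
  simp only [op_add, op_C_mul_X, op_C_mul_X_mul_X]
  convert P₃_mem using 1
  simp [P₃, η, d₁, d₂]
  noncomm_ring

theorem symbol_P₄_mem : (C (3 * X 0) * X 0 + C (2 * X 1) * X 1 + C (-4 * X 2) * X 2 :
    SymbolRing 3) ∈ charI := by
  have h (a : MvPolynomial (Fin 3) ℂ) (i : Fin 3) :
      (C a * X i : SymbolRing 3).IsHomogeneous 1 := by
    simpa using (isHomogeneous_C (Fin 3) a).mul (isHomogeneous_X _ i)
  refine mem_charIdeal_of_op_mem (k := 1) (r := C (-1)) (((h _ _).add (h _ _)).add (h _ _))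
    (by rw [totalDegree_C]; exact one_pos) ?_
  simp only [op_add, op_C, op_C_mul_X]
  convert P₄_mem using 1
  simp [P₄, x₁, x₂, η, d₁, d₂, dη, map_ofNat (ofPoly 3)]
  noncomm_ring

/-- The ideal of the union of the zero section and the conormal bundle of `η = 0`. -/
noncomputable def conormalIdeal : Ideal (SymbolRing 3) :=
  Ideal.span {X 0, X 1, C (X 2) * X 2}

/-- The symbols of P₃ and P₂ are multiples of ξ₁² and ξ₂², so primality is used to extract ξ₁ and
ξ₂; the symbol of P₄ then leaves -4ηξ_η. -/
theorem conormalIdeal_le {p : Ideal (SymbolRing 3)} [p.IsPrime] (h : charI ≤ p) :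
    conormalIdeal ≤ p := by
  have h0 : (X 0 : SymbolRing 3) ∈ p := by
    have := p.mul_mem_left (C (-1)) (h symbol_P₃_mem)
    rw [← mul_assoc, ← C_mul] at this
    exact or_self_iff.mp (Ideal.IsPrime.mem_or_mem ‹_› (by simpa using this))
  have h1 : (X 1 : SymbolRing 3) ∈ p := by
    have := p.mul_mem_left (C (C (1 / 4))) (h symbol_P₂_mem)
    rw [← mul_assoc, ← C_mul, ← map_ofNat C 4, ← C_mul] at this
    norm_num at this
    exact or_self_iff.mp (Ideal.IsPrime.mem_or_mem ‹_› this)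
  have h2 : (C (X 2) * X 2 : SymbolRing 3) ∈ p := by
    have := p.mul_mem_left (C (C (-1 / 4)))
      ((p.add_mem_iff_right (p.add_mem (p.mul_mem_left _ h0) (p.mul_mem_left _ h1))).mp
        (h symbol_P₄_mem))
    rw [← mul_assoc, ← C_mul, ← mul_assoc, ← map_ofNat C 4, ← C_neg, ← C_mul] at this
    norm_num at this
    exact this
  rw [conormalIdeal, Ideal.span_le]
  rintro _ (rfl | rfl | rfl)
  exacts [h0, h1, h2]

/-- The coordinate ring of the zero section and the conormal bundle of `η = 0` as a quotient of
`ℂ[x₁, x₂, η][ξ]`. -/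
noncomputable def toConormal : Polynomial (MvPolynomial (Fin 3) ℂ) →+*
    SymbolRing 3 ⧸ conormalIdeal :=
  (Ideal.Quotient.mk conormalIdeal).comp (Polynomial.eval₂RingHom C (X 2))

theorem toConormal_surjective : Function.Surjective toConormal := by
  rintro q
  obtain ⟨q, rfl⟩ := Ideal.Quotient.mk_surjective q
  induction q using MvPolynomial.induction_on with
  | C a => exact ⟨Polynomial.C a, by simp [toConormal]⟩
  | add p q hp hq =>
    obtain ⟨f, hf⟩ := hp
    obtain ⟨g, hg⟩ := hq
    exact ⟨f + g, by rw [map_add, map_add, hf, hg]⟩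
  | mul_X p i hp =>
    obtain ⟨f, hf⟩ := hp
    have h (i : Fin 3) (hi : (X i : SymbolRing 3) ∈ conormalIdeal) :
        toConormal 0 = Ideal.Quotient.mk conormalIdeal (p * X i) := by
      rw [map_zero, eq_comm, Ideal.Quotient.eq_zero_iff_mem]
      exact Ideal.mul_mem_left _ _ hi
    fin_cases i
    · exact ⟨0, h 0 (Ideal.subset_span (by simp))⟩
    · exact ⟨0, h 1 (Ideal.subset_span (by simp))⟩
    · refine ⟨f * Polynomial.X, ?_⟩
      rw [map_mul, map_mul, hf]
      simp [toConormal]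

theorem ringKrullDim_conormal_le : ringKrullDim (SymbolRing 3 ⧸ conormalIdeal) ≤ 3 := by
  let r : Polynomial (MvPolynomial (Fin 3) ℂ) := Polynomial.C (X 2) * Polynomial.X
  have hr : r ≠ 0 := by simp [r]
  have hle : Ideal.span {r} ≤ RingHom.ker toConormal := by
    rw [Ideal.span_singleton_le_iff_mem, RingHom.mem_ker]
    simp only [toConormal, RingHom.comp_apply, r, Ideal.Quotient.eq_zero_iff_mem]
    exact Ideal.subset_span (by simp)
  refine (ringKrullDim_le_of_surjective
    (R := Polynomial (MvPolynomial (Fin 3) ℂ) ⧸ Ideal.span {r})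
    (S := SymbolRing 3 ⧸ conormalIdeal) _
    (Ideal.Quotient.lift_surjective_of_surjective _ hle toConormal_surjective)).trans ?_
  -- ℂ[x₁, x₂, η][ξ] has dimension 4, and dividing by the nonzerodivisor ηξ lowers it by at least
  -- one.
  have h := ringKrullDim_quotient_succ_le_of_nonZeroDivisor (mem_nonZeroDivisors_of_ne_zero hr)
  rw [Polynomial.ringKrullDim_of_isNoetherianRing, ringKrullDim_polynomialRing] at h
  exact ENat.WithBot.add_le_add_one_right_iff.mp h

/-- Krull dimension depends only on the zero locus, so containment at the level of primes is enough.
-/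
theorem ringKrullDim_charI_le : ringKrullDim (SymbolRing 3 ⧸ charI) ≤ 3 := by
  refine le_trans ?_ ringKrullDim_conormal_le
  rw [ringKrullDim_quotient, ringKrullDim_quotient]
  have h : PrimeSpectrum.zeroLocus (charI : Set (SymbolRing 3)) ⊆
      PrimeSpectrum.zeroLocus conormalIdeal := fun p hp ↦ conormalIdeal_le hp
  exact Order.krullDim_le_of_strictMono (Set.inclusion h) fun _ _ hab ↦ hab

/-- A polynomial acts on K³ by scalar multiplication, so it cannot kill the cyclic vector unless it
is zero. -/
theorem eq_zero_of_ofPoly_mem (a : MvPolynomial (Fin 3) ℂ) (ha : ofPoly 3 a ∈ I) : a = 0 := by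
  have h : rep (ofPoly 3 a) ![1, 0, 0] = 0 := I_le_ker ha
  rw [rep_ofPoly] at h
  simpa [Algebra.smul_def] using congr_fun h 0

theorem le_ringKrullDim_charI : 3 ≤ ringKrullDim (SymbolRing 3 ⧸ charI) := by
  rw [← ringKrullDim_polynomialRing]
  have h : charI ≤ RingHom.ker (constantCoeff (σ := Fin 3)) :=
    charIdeal_le_ker_constantCoeff eq_zero_of_ofPoly_mem
  exact ringKrullDim_le_of_surjective (Ideal.Quotient.lift charI constantCoeff h)
    (Ideal.Quotient.lift_surjective_of_surjective _ h fun a ↦ ⟨C a, constantCoeff_C _ a⟩)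

theorem isHolonomic : IsHolonomic 3 (WeylAlgebra 3 ⧸ I) :=
  Or.inr ⟨cyclicFiltration I, isGoodFiltration_cyclicFiltration I,
    le_antisymm ringKrullDim_charI_le le_ringKrullDim_charI⟩

end Pearcey

theorem theorem7 :
    WeylAlgebra.IsHolonomic 3 (WeylAlgebra 3 ⧸ Pearcey.I) ∧
      WeylAlgebra.holonomicRank 3 (WeylAlgebra 3 ⧸ Pearcey.I) = 3 :=
  ⟨Pearcey.isHolonomic, Pearcey.holonomicRank_eq⟩
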